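/- Let $n\ge 3$ and let $(S;\mathcal R)$ be the Artin presentation of the positive braid monoid $B_n^+$: the generators are $S=\{\sigma_1,\dots,\sigma_{n-1}\}$ and the relations are $\sigma_i\sigma_j\sigma_i=\sigma_j\sigma_i\sigma_j$ for $|i-j|=1$ and $\sigma_i\sigma_j=\sigma_j\sigma_i$ for $|i-j|\ge 2$. Let $\equiv$ be the congruence on the free monoid $S^*$ generated by $\mathcal R$. Fix any linear order on $S$ and order $S^*$ by the induced homogeneous lexicographic (deglex) order: first by length, then lexicographically. A *Gröbner basis* of $(S;\mathcal R)$ is a set $\mathcal B$ of pairs $(u,v)$ with $u\equiv v$ and $u>v$ such that, whenever $w\equiv w'$ and $w>w'$, some $(u,v)\in\mathcal B$ has $u$ as a subword (block of consecutive letters) of $w$. It is *reduced* if, for all distinct pairs $(u,v),(u',v')\in\mathcal B$, the word $u'$ is a subword neither of $u$ nor of $v$. *Word reversing* with respect to a set of relations $\mathcal Q$ acts on words in the letters $s$ and $s^{-1}$ ($s\in S$): a step either deletes a subword $u^{-1}u$ with $u\in S^*$ nonempty, or replaces a subword $u^{-1}v$ with $u,v\in S^*$ nonempty by $v'u'^{-1}$,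 where $u',v'\in S^*$ and $uv'=vu'$ is a relation of $\mathcal Q$ (up to exchanging its two sides). The presentation $(S;\mathcal Q)$ is *R-complete* if $u\equiv_{\mathcal Q}v$ implies that $u^{-1}v$ can be reversed to the empty word, for all $u,v\in S^*$. The *R-completion* of $\mathcal R$ is the union of the sets obtained from $\mathcal R$ by repeating the following round: for all letters $s,r,t$ and all $u,v\in S^*$ such that $s^{-1}rr^{-1}t$ can be reversed to $uv^{-1}$, add the relation $su=tv$ if $(su)^{-1}(tv)$ cannot be reversed to the empty word (reversing with respect to the relations present at the start of the round). Then: 1. The presentation is *of type 1*: there is exactly one reduced Gröbner basis $\widehat{\mathcal R}^G$ of $(S;\mathcal R)$, it is infinite, the R-completion $\widehat{\mathcal R}^R$ of $\mathcal R$ is finite, and $\widehat{\mathcal R}^R\subsetneq\widehat{\mathcal R}^G$, where relations are compared as equations, i.e. up to exchanging their two sides. 2. The presentation $(S;\mathcal R)$ is R-complete. 3. For any two adjacent generators $a<b$ (that is, $\{a,b\}=\{\sigma_i,\sigma_{i+1}\}$ for some $i$) and every $k\ge 2$, the relation $ba^kba=aba^2b^{k-1}$ belongs to $\widehat{\mathcal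 R}^G$, with leading word $ba^kba$. -/

import Mathlib

namespace WordPres

/-- A set of relations on the alphabet `S`: the pair `(u, v)` stands for the relation `u = v`. -/
abbrev Rels (S : Type*) := Set (FreeMonoid S × FreeMonoid S)

variable {S : Type*}

/-- The smallest congruence on the free monoid that contains the relations. -/
def Eqv (R : Rels S) (u v : FreeMonoid S) : Prop :=
  conGen (fun x y => (x, y) ∈ R) u v

/-- `u = v` is a relation of the presentation, read as an (unoriented) equation. -/
def IsRel (R : Rels S) (u v : FreeMonoid S) : Prop :=
  (u, v) ∈ R ∨ (v, u) ∈ R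

/-- The set of equations `u = v` of a set of relations, regardless of the side on which each word
is written. -/
def equations (R : Rels S) : Set (Sym2 (FreeMonoid S)) :=
  (fun p => s(p.1, p.2)) '' R

/-! ### Groebner bases -/

/-- The homogeneous lexicographic order on words induced by the order `r` of the letters:
`u` is before `v` if it is shorter, or if it has the same length and is lexicographically
smaller. -/
def DegLex (r : S → S → Prop) (u v : FreeMonoid S) : Prop :=
  List.Shortlex r u.toList v.toList

/-- `u` is a subword (a block of consecutive letters) of `w`. -/
def IsSubword (u w : FreeMonoid S) : Prop :=
  ∃ x y : FreeMonoid S, w = x * u * y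

/-- `B` is a Groebner basis of the presentation `(S; R)` for the order `lt` on words. -/
structure IsGroebnerBasis (lt : FreeMonoid S → FreeMonoid S → Prop) (R B : Rels S) : Prop where
  subset_eqv : ∀ p ∈ B, Eqv R p.1 p.2
  oriented : ∀ p ∈ B, lt p.2 p.1
  exists_subword : ∀ w w' : FreeMonoid S, Eqv R w w' → lt w' w → ∃ p ∈ B, IsSubword p.1 w

/-- The relation `q` (whose leading word is its first component) can be used to reduce one of the
two sides of the relation `p`. -/
def Reduces (lt : FreeMonoid S → FreeMonoid S → Prop) (q p : FreeMonoid S × FreeMonoid S) : Prop :=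
  lt q.2 q.1 ∧ (IsSubword q.1 p.1 ∨ IsSubword q.1 p.2)

/-- No relation of `B` can be reduced by another relation of `B`. -/
def IsReduced (lt : FreeMonoid S → FreeMonoid S → Prop) (B : Rels S) : Prop :=
  ∀ p ∈ B, ∀ q ∈ B, q ≠ p → ¬ Reduces lt q p

/-- `B` is a reduced Groebner basis of `(S; R)`. -/
def IsReducedGroebnerBasis (lt : FreeMonoid S → FreeMonoid S → Prop) (R B : Rels S) : Prop :=
  IsGroebnerBasis lt R B ∧ IsReduced lt B

/-! ### Word reversing -/

/-- The positive word `u`, as a word in the letters `s` (`Sum.inl s`) and their formal inverses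
(`Sum.inr s`). -/
def pos (u : FreeMonoid S) : FreeMonoid (S ⊕ S) :=
  FreeMonoid.ofList (u.toList.map Sum.inl)

/-- The formal inverse of the word `u = s₁ ⋯ sₘ`, that is, `sₘ⁻¹ ⋯ s₁⁻¹`. -/
def neg (u : FreeMonoid S) : FreeMonoid (S ⊕ S) :=
  FreeMonoid.ofList (u.toList.map Sum.inr).reverse

/-- One step of word reversing. -/
inductive RevStep (R : Rels S) : FreeMonoid (S ⊕ S) → FreeMonoid (S ⊕ S) → Prop
  | delete (x y : FreeMonoid (S ⊕ S)) (u : FreeMonoid S) (hu : u ≠ 1) :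
      RevStep R (x * (neg u * pos u) * y) (x * y)
  | replace (x y : FreeMonoid (S ⊕ S)) (u v u' v' : FreeMonoid S) (hu : u ≠ 1) (hv : v ≠ 1)
      (h : IsRel R (u * v') (v * u')) :
      RevStep R (x * (neg u * pos v) * y) (x * (pos v' * neg u') * y)

/-- `w` is reversible to `w'`. -/
def Rev (R : Rels S) : FreeMonoid (S ⊕ S) → FreeMonoid (S ⊕ S) → Prop :=
  Relation.ReflTransGen (RevStep R)

/-- Completeness for word reversing: reversing detects every equivalence of words. -/
def RComplete (R : Rels S) : Prop :=
  ∀ u v : FreeMonoid S, Eqv R u v → Rev R (neg u * pos v) 1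

/-- One round of the reversing-completion procedure: for all letters `s, r, t` and all words
`u v⁻¹` to which `s⁻¹ r r⁻¹ t` is reversible, the relation `s u = t v` is added whenever
`(s u)⁻¹ (t v)` is not reversible to the empty word. -/
def rCompletionStep (R : Rels S) : Rels S :=
  R ∪ {p | ∃ (s r t : S) (u v : FreeMonoid S),
    Rev R (neg (.of s) * pos (.of r) * neg (.of r) * pos (.of t)) (pos u * neg v) ∧
    ¬ Rev R (neg (.of s * u) * pos (.of t * v)) 1 ∧
    p = (.of s * u, .of t * v)}

/-- The R-completion: all the relations obtained by repeating the completion rounds. -/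
def rCompletion (R : Rels S) : Rels S :=
  ⋃ k : ℕ, rCompletionStep^[k] R

/-! ### Comparison of the two completions -/

/-- Type 1: there is exactly one reduced Groebner basis (the G-completion), and the R-completion is
a proper subset of it, as a set of equations, the R-completion being finite and the G-completion
infinite. -/
def IsType1 (lt : FreeMonoid S → FreeMonoid S → Prop) (R : Rels S) : Prop :=
  (∃! G : Rels S, IsReducedGroebnerBasis lt R G) ∧
  ∀ G : Rels S, IsReducedGroebnerBasis lt R G →
    equations (rCompletion R) ⊂ equations G ∧
    (equations (rCompletion R)).Finite ∧
    (equations G).Infinite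

/-! ### Braid monoids -/

/-- The `n - 1` generators of the braid monoid on `n` strands; `σ i` is the generator usually
numbered `i + 1`. -/
abbrev σ {n : ℕ} (i : Fin (n - 1)) : FreeMonoid (Fin (n - 1)) := FreeMonoid.of i

/-- The relations of the Artin presentation of the positive braid monoid on `n` strands. -/
def artin (n : ℕ) : Rels (Fin (n - 1)) :=
  {p | ∃ i j : Fin (n - 1), |((j : ℕ) : ℤ) - ((i : ℕ) : ℤ)| = 1 ∧
    p = (σ i * σ j * σ i, σ j * σ i * σ j)} ∪
  {p | ∃ i j : Fin (n - 1), 2 ≤ |((j : ℕ) : ℤ) - ((i : ℕ) : ℤ)| ∧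
    p = (σ i * σ j, σ j * σ i)}

end WordPres

/-! Garside's lemma (`meet_of_gen_mul_eq`) carries both halves: an equality `σ_s u = σ_t v` in the
braid monoid always factors through the obvious least common right multiple of the two generators.
It contains left cancellation and follows from the cube condition `Meet.trans`.

Reversing: when two words have a common right multiple, filling a grid with defining relations
terminates (`exists_rev_of_mul_eq`); for equivalent words the multiple is the class itself, which
forces the empty word. Reversing is also sound: it preserves paths in the Cayley graph. Hence every
relation proposed by a completion round is already detected, and the R-completion is `artin n`, a
finite set.

Gröbner side: over a finite ordered alphabet the only reduced basis is `canonicalBasis`, which pairs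
each minimal non-normal word with the normal word of its class. Garside's lemma certifies normality:
a class has a word starting with a given letter only if certain smaller equations are solvable, and
descent excludes them. This places the Artin relations and the family `b a^k b a = a b a² b^(k-1)`
in the basis. The family makes the basis infinite, so the inclusion is proper. -/

namespace WordPres

open FreeMonoid

/-! ### Common right multiples in braid monoids -/

/-- The generators with indices `i` and `j` satisfy a braid relation of length three. -/
def Adj {N : ℕ} (i j : Fin N) : Prop := (i : ℕ) + 1 = j ∨ (j : ℕ) + 1 = i

/-- The generators with indices `i` and `j` are distinct and commute. -/
def Far {N : ℕ} (i j : Fin N) : Prop := (i : ℕ) + 2 ≤ j ∨ (j : ℕ) + 2 ≤ i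

theorem adj_iff {N : ℕ} (i j : Fin N) : Adj i j ↔ |((j : ℕ) : ℤ) - ((i : ℕ) : ℤ)| = 1 := by
  rw [abs_eq zero_le_one, Adj]; omega

theorem far_iff {N : ℕ} (i j : Fin N) : Far i j ↔ 2 ≤ |((j : ℕ) : ℤ) - ((i : ℕ) : ℤ)| := by
  rw [le_abs, Far]; omega

theorem eq_or_adj_or_far {N : ℕ} (i j : Fin N) : i = j ∨ Adj i j ∨ Far i j := by
  rw [Adj, Far, Fin.ext_iff]; omega

theorem Adj.symm {N : ℕ} {i j : Fin N} (h : Adj i j) : Adj j i := Or.symm h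

theorem Far.symm {N : ℕ} {i j : Fin N} (h : Far i j) : Far j i := Or.symm h

theorem Adj.ne {N : ℕ} {i j : Fin N} (h : Adj i j) : i ≠ j := by
  rintro rfl; rw [Adj] at h; omega

theorem Far.ne {N : ℕ} {i j : Fin N} (h : Far i j) : i ≠ j := by
  rintro rfl; rw [Far] at h; omega

theorem Adj.not_far {N : ℕ} {i j : Fin N} (h : Adj i j) : ¬ Far i j := by
  rw [Adj] at h; rw [Far]; omega

section Meet

variable {N : ℕ} {M : Type*} [Monoid M] {x : Fin N → M}

/-- The equality `x s * u = x t * v` follows from the least common right multiple of `x s` and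
`x t`. -/
def Meet (x : Fin N → M) (s t : Fin N) (u v : M) : Prop :=
  (s = t ∧ u = v) ∨
  (Adj s t ∧ ∃ w, u = x t * (x s * w) ∧ v = x s * (x t * w)) ∨
  (Far s t ∧ ∃ w, u = x t * w ∧ v = x s * w)

theorem Meet.symm {s t : Fin N} {u v : M} (h : Meet x s t u v) : Meet x t s v u := by
  rcases h with ⟨rfl, rfl⟩ | ⟨h, w, hu, hv⟩ | ⟨h, w, hu, hv⟩
  · exact .inl ⟨rfl, rfl⟩
  · exact .inr (.inl ⟨h.symm, w, hv, hu⟩)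
  · exact .inr (.inr ⟨h.symm, w, hv, hu⟩)

theorem Meet.mul_right {s t : Fin N} {u v : M} (h : Meet x s t u v) (z : M) :
    Meet x s t (u * z) (v * z) := by
  rcases h with ⟨rfl, rfl⟩ | ⟨h, w, rfl, rfl⟩ | ⟨h, w, rfl, rfl⟩
  · exact .inl ⟨rfl, rfl⟩
  · exact .inr (.inl ⟨h, w * z, by simp only [mul_assoc], by simp only [mul_assoc]⟩)
  · exact .inr (.inr ⟨h, w * z, by simp only [mul_assoc], by simp only [mul_assoc]⟩)

theorem Meet.cancel {s : Fin N} {u v : M} (h : Meet x s s u v) : u = v := by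
  rcases h with h | h | h
  · exact h.2
  · exact absurd rfl h.1.ne
  · exact absurd rfl h.1.ne

theorem Meet.of_adj {s t : Fin N} {u v : M} (h : Meet x s t u v) (hst : Adj s t) :
    ∃ w, u = x t * (x s * w) ∧ v = x s * (x t * w) := by
  rcases h with h | h | h
  · exact absurd h.1 hst.ne
  · exact h.2
  · exact absurd h.1 hst.not_far

theorem Meet.of_far {s t : Fin N} {u v : M} (h : Meet x s t u v) (hst : Far s t) :
    ∃ w, u = x t * w ∧ v = x s * w := by
  rcases h with h | h | h
  · exact absurd h.1 hst.ne
  · exact absurd hst h.1.not_far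
  · exact h.2

/-- The cube condition for the triple of generators `s, r, t`. -/
theorem Meet.trans
    (comm : ∀ s t, Far s t → ∀ w, x s * (x t * w) = x t * (x s * w))
    (braid : ∀ s t, Adj s t → ∀ w, x s * (x t * (x s * w)) = x t * (x s * (x t * w)))
    {len : M → ℕ} (hlen : ∀ s u, len (x s * u) = len u + 1) {m : ℕ}
    (H : ∀ s t u v, len u < m → x s * u = x t * v → Meet x s t u v)
    {s r t : Fin N} {u p v : M} (hp : len p = m)
    (h₁ : Meet x s r u p) (h₂ : Meet x r t p v) : Meet x s t u v := by
  rcases h₁ with ⟨rfl, rfl⟩ | ⟨hsr, w₁, rfl, hp₁⟩ | ⟨hsr, w₁, rfl, hp₁⟩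
  · exact h₂
  · rcases h₂ with ⟨rfl, rfl⟩ | ⟨hrt, w₂, hp₂, rfl⟩ | ⟨hrt, w₂, hp₂, rfl⟩
    · exact .inr (.inl ⟨hsr, w₁, rfl, hp₁⟩)
    · have l₁ : len w₁ + 2 = m := by rw [← hp, hp₁, hlen, hlen]
      have l₂ : len w₂ + 2 = m := by rw [← hp, hp₂, hlen, hlen]
      rcases eq_or_adj_or_far s t with rfl | hst | hst
      · have h := (H _ _ _ _ (by rw [hlen]; omega) (hp₁.symm.trans hp₂)).cancel
        have h := (H _ _ _ _ (by omega) h).cancel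
        exact .inl ⟨rfl, by rw [h]⟩
      -- On a line of indices no three are pairwise adjacent.
      · exfalso; revert hsr hrt hst; simp only [Adj]; omega
      · obtain ⟨y, h₁, h₂⟩ := (H _ _ _ _ (by rw [hlen]; omega) (hp₁.symm.trans hp₂)).of_far hst
        obtain ⟨a, rfl, ha⟩ := (H _ _ _ _ (by omega) h₁).of_adj hrt
        obtain ⟨b, rfl, hb⟩ := (H _ _ _ _ (by omega) h₂).of_adj hsr.symm
        simp only [hlen] at l₁ l₂
        have h := (H _ _ _ _ (by simp only [hlen]; omega) (ha.symm.trans hb)).cancel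
        obtain ⟨w, rfl, rfl⟩ := (H _ _ _ _ (by omega) h).of_far hst.symm
        -- Type `A₃` with `r` in the middle: the common multiple is the length-six Garside element
        -- `s t r t s r`, followed by `w`.
        refine .inr (.inr ⟨hst, x r * (x t * (x s * (x r * w))), ?_, ?_⟩)
        · rw [comm s t hst, braid s r hsr, braid r t hrt]
        · rw [comm t s hst.symm, braid t r hrt.symm, braid r s hsr.symm, comm t s hst.symm]
    · have l₁ : len w₁ + 2 = m := by rw [← hp, hp₁, hlen, hlen]
      have l₂ : len w₂ + 1 = m := by rw [← hp, hp₂, hlen]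
      rcases eq_or_adj_or_far s t with rfl | hst | hst
      · exact absurd hrt hsr.symm.not_far
      · obtain ⟨y, h₁, rfl⟩ := (H _ _ _ _ (by rw [hlen]; omega) (hp₁.symm.trans hp₂)).of_adj hst
        obtain ⟨a, rfl, h₂⟩ := (H _ _ _ _ (by omega) h₁).of_far hrt
        simp only [hlen] at l₁ l₂
        obtain ⟨z, rfl, rfl⟩ := (H _ _ _ _ (by omega) h₂).of_adj hsr
        refine .inr (.inl ⟨hst, x r * (x s * (x t * z)), ?_, ?_⟩)
        · rw [braid s t hst, comm t r hrt.symm, comm r t hrt (x s * _), braid r s hsr.symm]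
        · rw [comm t r hrt.symm, braid r s hsr.symm, braid s t hst, comm r t hrt]
      · obtain ⟨y, h₁, rfl⟩ := (H _ _ _ _ (by rw [hlen]; omega) (hp₁.symm.trans hp₂)).of_far hst
        obtain ⟨a, rfl, rfl⟩ := (H _ _ _ _ (by omega) h₁).of_far hrt
        refine .inr (.inr ⟨hst, x r * (x s * a), ?_, ?_⟩)
        · rw [comm s t hst, comm r t hrt]
        · rw [braid r s hsr.symm]
  · rcases h₂ with ⟨rfl, rfl⟩ | ⟨hrt, w₂, hp₂, rfl⟩ | ⟨hrt, w₂, hp₂, rfl⟩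
    · exact .inr (.inr ⟨hsr, w₁, rfl, hp₁⟩)
    · have l₁ : len w₁ + 1 = m := by rw [← hp, hp₁, hlen]
      have l₂ : len w₂ + 2 = m := by rw [← hp, hp₂, hlen, hlen]
      rcases eq_or_adj_or_far s t with rfl | hst | hst
      · exact absurd hsr hrt.symm.not_far
      · obtain ⟨y, rfl, h₁⟩ := (H _ _ _ _ (by omega) (hp₁.symm.trans hp₂)).of_adj hst
        obtain ⟨a, rfl, h₂⟩ := (H _ _ _ _ (by omega) h₁).of_far hsr.symm
        simp only [hlen] at l₁ l₂
        obtain ⟨z, rfl, rfl⟩ := (H _ _ _ _ (by omega) h₂).of_adj hrt.symm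
        refine .inr (.inl ⟨hst, x r * (x t * (x s * z)), ?_, ?_⟩)
        · rw [comm s r hsr, braid r t hrt, braid t s hst.symm, comm r s hsr.symm]
        · rw [braid t s hst.symm, comm s r hsr, comm r s hsr.symm (x t * _), braid r t hrt]
      · obtain ⟨y, rfl, h₁⟩ := (H _ _ _ _ (by omega) (hp₁.symm.trans hp₂)).of_far hst
        obtain ⟨a, rfl, rfl⟩ := (H _ _ _ _ (by omega) h₁).of_far hsr.symm
        refine .inr (.inr ⟨hst, x r * (x t * a), ?_, ?_⟩)
        · rw [braid r t hrt]
        · rw [comm t s hst.symm, comm r s hsr.symm]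
    · have l₁ : len w₁ + 1 = m := by rw [← hp, hp₁, hlen]
      rcases eq_or_adj_or_far s t with rfl | hst | hst
      · exact .inl ⟨rfl, by rw [(H _ _ _ _ (by omega) (hp₁.symm.trans hp₂)).cancel]⟩
      · obtain ⟨y, rfl, rfl⟩ := (H _ _ _ _ (by omega) (hp₁.symm.trans hp₂)).of_adj hst
        refine .inr (.inl ⟨hst, x r * y, ?_, ?_⟩)
        · rw [comm r t hrt, comm r s hsr.symm]
        · rw [comm r s hsr.symm, comm r t hrt]
      · obtain ⟨y, rfl, rfl⟩ := (H _ _ _ _ (by omega) (hp₁.symm.trans hp₂)).of_far hst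
        refine .inr (.inr ⟨hst, x r * y, ?_, ?_⟩)
        · rw [comm r t hrt]
        · rw [comm r s hsr.symm]

end Meet

/-! ### The monoid defined by a presentation -/

/-- The monoid defined by a presentation. -/
abbrev PresMonoid {S : Type*} (R : Rels S) : Type _ := (conGen fun x y => (x, y) ∈ R).Quotient

/-- The class of a word. -/
def cls {S : Type*} (R : Rels S) : FreeMonoid S →* PresMonoid R := Con.mk' _

theorem cls_eq_iff {S : Type*} {R : Rels S} {u v : FreeMonoid S} :
    cls R u = cls R v ↔ Eqv R u v := Con.eq _

theorem cls_surjective {S : Type*} (R : Rels S) : Function.Surjective (cls R) :=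
  Con.mk'_surjective

theorem cls_eq_of_isRel {S : Type*} {R : Rels S} {u v : FreeMonoid S} (h : IsRel R u v) :
    cls R u = cls R v :=
  h.elim (fun h => cls_eq_iff.2 (.of _ _ h)) fun h => (cls_eq_iff.2 (.of _ _ h)).symm

variable {n : ℕ}

theorem isRel_far {i j : Fin (n - 1)} (h : Far i j) : IsRel (artin n) (σ i * σ j) (σ j * σ i) :=
  .inl (.inr ⟨i, j, (far_iff i j).1 h, rfl⟩)

theorem isRel_adj {i j : Fin (n - 1)} (h : Adj i j) :
    IsRel (artin n) (σ i * σ j * σ i) (σ j * σ i * σ j) :=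
  .inl (.inl ⟨i, j, (adj_iff i j).1 h, rfl⟩)

/-- The generators of the braid monoid. -/
def gen (n : ℕ) (i : Fin (n - 1)) : PresMonoid (artin n) := cls (artin n) (σ i)

theorem gen_comm {i j : Fin (n - 1)} (h : Far i j) (w) :
    gen n i * (gen n j * w) = gen n j * (gen n i * w) := by
  have := cls_eq_of_isRel (isRel_far h)
  simp only [map_mul] at this
  simp only [gen, ← mul_assoc, this]

theorem gen_braid {i j : Fin (n - 1)} (h : Adj i j) (w) :
    gen n i * (gen n j * (gen n i * w)) = gen n j * (gen n i * (gen n j * w)) := by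
  have := cls_eq_of_isRel (isRel_adj h)
  simp only [map_mul] at this
  simp only [gen, ← mul_assoc, this]

theorem Eqv.length_eq {u v : FreeMonoid (Fin (n - 1))} (h : Eqv (artin n) u v) :
    u.length = v.length := by
  induction h with
  | of _ _ h => rcases h with ⟨i, j, -, h⟩ | ⟨i, j, -, h⟩ <;> cases h <;> rfl
  | refl => rfl
  | symm _ ih => exact ih.symm
  | trans _ _ ih₁ ih₂ => exact ih₁.trans ih₂
  | mul _ _ ih₁ ih₂ => rw [length_mul, length_mul, ih₁, ih₂]

theorem Eqv.mem_iff {u v : FreeMonoid (Fin (n - 1))} (h : Eqv (artin n) u v) (c : Fin (n - 1)) :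
    c ∈ u ↔ c ∈ v := by
  induction h with
  | of _ _ h =>
    rcases h with ⟨i, j, -, h⟩ | ⟨i, j, -, h⟩ <;> cases h <;> simp only [mem_mul, mem_of] <;> tauto
  | refl => rfl
  | symm _ ih => exact ih.symm
  | trans _ _ ih₁ ih₂ => exact ih₁.trans ih₂
  | mul _ _ ih₁ ih₂ => rw [mem_mul, mem_mul, ih₁, ih₂]

/-- The length of an element of the braid monoid. -/
def len (n : ℕ) (a : PresMonoid (artin n)) : ℕ :=
  Con.liftOn a FreeMonoid.length fun _ _ h => Eqv.length_eq h

theorem len_cls (u : FreeMonoid (Fin (n - 1))) : len n (cls _ u) = u.length := rfl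

theorem len_gen_mul (s : Fin (n - 1)) (a) : len n (gen n s * a) = len n a + 1 := by
  obtain ⟨u, rfl⟩ := cls_surjective _ a
  rw [gen, ← map_mul, len_cls, len_cls, length_mul, length_of, add_comm]

theorem len_one : len n 1 = 0 := rfl

theorem of_mul_inj {S : Type*} {s t : S} {u v : FreeMonoid S} :
    FreeMonoid.of s * u = .of t * v ↔ s = t ∧ u = v :=
  List.cons.injEq s u t v ▸ Iff.rfl

/-- Garside's lemma, by induction on the length of the words. -/
theorem meet_of_length_le (m : ℕ) (s t : Fin (n - 1)) (u v : PresMonoid (artin n))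
    (hu : len n u < m) (h : gen n s * u = gen n t * v) : Meet (gen n) s t u v := by
  induction m generalizing s t u v with
  | zero => omega
  | succ m IH =>
    -- An inner induction on the derivation of the congruence needs arbitrary words `p`, `q`, whose
    -- first letters are split off only afterwards.
    suffices H : ∀ p q : FreeMonoid (Fin (n - 1)), Eqv (artin n) p q → p.length ≤ m + 1 →
        ∀ s t u v, p = .of s * u → q = .of t * v →
          Meet (gen n) s t (cls _ u) (cls _ v) by
      obtain ⟨u, rfl⟩ := cls_surjective _ u
      obtain ⟨v, rfl⟩ := cls_surjective _ v
      rw [gen, gen, ← map_mul, ← map_mul, cls_eq_iff] at h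
      refine H _ _ h ?_ s t u v rfl rfl
      rw [len_cls] at hu
      rw [length_mul, length_of]; omega
    intro p q hpq
    induction hpq with
    | of _ _ h =>
      rintro - s t u v hu hv
      rcases h with ⟨i, j, hij, h⟩ | ⟨i, j, hij, h⟩ <;> cases h
      · rw [mul_assoc, of_mul_inj] at hu hv
        obtain ⟨rfl, rfl⟩ := hu
        obtain ⟨rfl, rfl⟩ := hv
        exact .inr (.inl ⟨(adj_iff _ _).2 hij, 1, by simp [gen], by simp [gen]⟩)
      · rw [of_mul_inj] at hu hv
        obtain ⟨rfl, rfl⟩ := hu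
        obtain ⟨rfl, rfl⟩ := hv
        exact .inr (.inr ⟨(far_iff _ _).2 hij, 1, by simp [gen], by simp [gen]⟩)
    | refl p =>
      rintro - s t u v rfl hv
      obtain ⟨rfl, rfl⟩ := of_mul_inj.1 hv
      exact .inl ⟨rfl, rfl⟩
    | symm h ih =>
      intro hl s t u v hu hv
      exact (ih ((Eqv.length_eq h).trans_le hl) t s v u hv hu).symm
    | @trans p q z h₁ h₂ ih₁ ih₂ =>
      intro hl s t u v hu hv
      have e₁ := Eqv.length_eq h₁
      -- The intermediate word is as long as `p`, hence has a first letter `r`; the cube condition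
      -- removes it, using the outer hypothesis on shorter tails.
      cases q using FreeMonoid.casesOn with
      | one => rw [hu, length_mul, length_of, length_one] at e₁; omega
      | of_mul r q =>
        have i₁ := ih₁ hl s r u q hu rfl
        have i₂ := ih₂ (e₁ ▸ hl) r t q v rfl hv
        refine Meet.trans (fun _ _ => gen_comm) (fun _ _ => gen_braid) len_gen_mul
          (fun s t u v hu => IH s t u v ?_) rfl i₁ i₂
        rw [len_cls] at hu
        rw [e₁, length_mul, length_of] at hl
        omega
    | @mul a b c d h₁ h₂ ih₁ ih₂ =>
      intro hl s t u v hu hv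
      have e₁ := Eqv.length_eq h₁
      have h₂' := cls_eq_iff.2 h₂
      rw [length_mul] at hl
      -- First letters come from the left factors unless these are empty; in the first case the
      -- right factors only contribute a right multiplication.
      cases a using FreeMonoid.casesOn with
      | one =>
        have : b = 1 := length_eq_zero.1 e₁.symm
        subst this
        rw [one_mul] at hu hv
        exact ih₂ (by omega) s t u v hu hv
      | of_mul i a =>
        cases b using FreeMonoid.casesOn with
        | one => rw [length_mul, length_of, length_one] at e₁; omega
        | of_mul j b =>
          rw [mul_assoc, of_mul_inj] at hu hv
          obtain ⟨rfl, rfl⟩ := hu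
          obtain ⟨rfl, rfl⟩ := hv
          rw [map_mul, map_mul, h₂']
          exact (ih₁ (by omega) _ _ a b rfl rfl).mul_right _

/-- Garside's lemma. -/
theorem meet_of_gen_mul_eq {s t : Fin (n - 1)} {u v : PresMonoid (artin n)}
    (h : gen n s * u = gen n t * v) : Meet (gen n) s t u v :=
  meet_of_length_le _ s t u v (Nat.lt_succ_self _) h

/-! ### Soundness of word reversing -/

section Reversing

variable {S : Type*} {R : Rels S}

theorem pos_one : pos (1 : FreeMonoid S) = 1 := rfl

theorem neg_one : neg (1 : FreeMonoid S) = 1 := rfl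

theorem pos_mul (u v : FreeMonoid S) : pos (u * v) = pos u * pos v := by
  simp [pos, ofList_append]

theorem neg_mul (u v : FreeMonoid S) : neg (u * v) = neg v * neg u := by
  simp [neg, ofList_append]

theorem pos_of (s : S) : pos (.of s) = .of (Sum.inl s) := rfl

theorem neg_of (s : S) : neg (.of s) = .of (Sum.inr s) := rfl

/-- The signed word labels a path from `a` to `b` in the Cayley graph of the presented monoid. -/
def Traced (R : Rels S) (w : FreeMonoid (S ⊕ S)) (a b : PresMonoid R) : Prop :=
  FreeMonoid.recOn (motive := fun _ => PresMonoid R → Prop) w (fun a => a = b)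
    (fun l _ ih a => l.elim (fun s => ih (a * cls R (.of s)))
      fun s => ∃ c, a = c * cls R (.of s) ∧ ih c) a

theorem traced_one {a b : PresMonoid R} : Traced R 1 a b ↔ a = b := Iff.rfl

theorem traced_inl_mul {s : S} {w : FreeMonoid (S ⊕ S)} {a b : PresMonoid R} :
    Traced R (.of (.inl s) * w) a b ↔ Traced R w (a * cls R (.of s)) b := Iff.rfl

theorem traced_inr_mul {s : S} {w : FreeMonoid (S ⊕ S)} {a b : PresMonoid R} :
    Traced R (.of (.inr s) * w) a b ↔ ∃ c, a = c * cls R (.of s) ∧ Traced R w c b := Iff.rfl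

theorem traced_mul {w w' : FreeMonoid (S ⊕ S)} {a b : PresMonoid R} :
    Traced R (w * w') a b ↔ ∃ c, Traced R w a c ∧ Traced R w' c b := by
  induction w using FreeMonoid.inductionOn' generalizing a with
  | one => simp [traced_one]
  | of_mul l w ih =>
    rw [mul_assoc]
    rcases l with s | s
    · simp only [traced_inl_mul, ih]
    · simp only [traced_inr_mul, ih]
      constructor
      · rintro ⟨d, h, c, h₁, h₂⟩
        exact ⟨c, ⟨d, h, h₁⟩, h₂⟩
      · rintro ⟨c, ⟨d, h, h₁⟩, h₂⟩
        exact ⟨d, h, c, h₁, h₂⟩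

theorem traced_pos {u : FreeMonoid S} {a b : PresMonoid R} :
    Traced R (pos u) a b ↔ a * cls R u = b := by
  induction u using FreeMonoid.inductionOn' generalizing a with
  | one => rw [pos_one, map_one, mul_one, traced_one]
  | of_mul s u ih => rw [pos_mul, pos_of, traced_inl_mul, ih, map_mul, mul_assoc]

theorem traced_neg {u : FreeMonoid S} {a b : PresMonoid R} :
    Traced R (neg u) a b ↔ a = b * cls R u := by
  induction u using FreeMonoid.inductionOn' generalizing b with
  | one => rw [neg_one, map_one, mul_one, traced_one]
  | of_mul s u ih =>
    rw [neg_mul, neg_of, traced_mul, map_mul, ← mul_assoc, ← mul_one (FreeMonoid.of (Sum.inr s))]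
    simp only [ih, traced_inr_mul, traced_one]
    constructor
    · rintro ⟨_, rfl, _, rfl, rfl⟩; rfl
    · rintro rfl; exact ⟨_, rfl, _, rfl, rfl⟩

/-- If the old path runs `c u → c → c v`, the new one exists because `c u v' = c v u'`. No
cancellation in the monoid is needed. -/
theorem RevStep.traced {w w' : FreeMonoid (S ⊕ S)} (h : RevStep R w w') {a b : PresMonoid R}
    (hw : Traced R w a b) : Traced R w' a b := by
  cases h with
  | delete x y u hu =>
    simp only [traced_mul, traced_neg, traced_pos] at hw ⊢
    obtain ⟨_, ⟨_, hx, _, rfl, rfl⟩, hy⟩ := hw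
    exact ⟨_, hx, hy⟩
  | replace x y u v u' v' hu hv h =>
    simp only [traced_mul, traced_neg, traced_pos] at hw ⊢
    obtain ⟨_, ⟨_, hx, _, rfl, rfl⟩, hy⟩ := hw
    refine ⟨_, ⟨_, hx, _, rfl, ?_⟩, hy⟩
    have := cls_eq_of_isRel h
    rw [map_mul, map_mul] at this
    rw [mul_assoc, this, mul_assoc]

theorem Rev.traced {w w' : FreeMonoid (S ⊕ S)} (h : Rev R w w') {a b : PresMonoid R}
    (hw : Traced R w a b) : Traced R w' a b := by
  induction h with
  | refl => exact hw
  | tail _ h ih => exact h.traced ih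

theorem eqv_of_rev {s r t : S} {u v : FreeMonoid S}
    (h : Rev R (neg (.of s) * pos (.of r) * neg (.of r) * pos (.of t)) (pos u * neg v)) :
    Eqv R (.of s * u) (.of t * v) := by
  have H : Traced R (pos u * neg v) (cls R (.of s)) (cls R (.of t)) := by
    apply h.traced
    simp only [traced_mul, traced_neg, traced_pos]
    -- The word `s⁻¹ r r⁻¹ t` traces the path `s → 1 → r → 1 → t`.
    exact ⟨1, ⟨_, ⟨1, (one_mul _).symm, rfl⟩, rfl⟩, one_mul _⟩
  simp only [traced_mul, traced_neg, traced_pos] at H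
  obtain ⟨_, rfl, h⟩ := H
  rwa [← map_mul, ← map_mul, cls_eq_iff] at h

/-- By soundness a candidate relation holds in the monoid, so completeness contradicts the condition
for adding it. -/
theorem rCompletion_of_rComplete (h : RComplete R) : rCompletion R = R := by
  have hR : rCompletionStep R = R := by
    refine Set.union_eq_self_of_subset_right ?_
    rintro _ ⟨s, r, t, u, v, hrev, hn, rfl⟩
    exact absurd (h _ _ (eqv_of_rev hrev)) hn
  rw [rCompletion]
  simp only [Function.iterate_fixed hR, Set.iUnion_const]

theorem Rev.trans {w₁ w₂ w₃ : FreeMonoid (S ⊕ S)} (h₁ : Rev R w₁ w₂) (h₂ : Rev R w₂ w₃) :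
    Rev R w₁ w₃ := Relation.ReflTransGen.trans h₁ h₂

theorem Rev.mul_mul {w w' : FreeMonoid (S ⊕ S)} (h : Rev R w w') (x y : FreeMonoid (S ⊕ S)) :
    Rev R (x * w * y) (x * w' * y) := by
  refine Relation.ReflTransGen.lift (fun w => x * w * y) (fun w w' h => ?_) _ _ h
  cases h with
  | delete x' y' u hu => simpa only [Function.onFun, mul_assoc] using RevStep.delete (R := R) (x * x') (y' * y) u hu
  | replace x' y' u v u' v' hu hv h =>
    simpa only [Function.onFun, mul_assoc] using RevStep.replace (R := R) (x * x') (y' * y) u v u' v' hu hv h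

theorem rev_letters {s t : S} {c d : FreeMonoid S} (h : IsRel R (.of s * c) (.of t * d))
    (u v : FreeMonoid S) :
    Rev R (neg (.of s * u) * pos (.of t * v)) (neg u * pos c * (neg d * pos v)) := by
  have := RevStep.replace (neg u) (pos v) _ _ _ _ (of_ne_one s) (of_ne_one t) h
  rw [neg_mul, pos_mul]
  simp only [mul_assoc] at this ⊢
  exact .single this

theorem rev_letter_self (s : S) (u v : FreeMonoid S) :
    Rev R (neg (.of s * u) * pos (.of s * v)) (neg u * pos v) := by
  have := RevStep.delete (R := R) (neg u) (pos v) _ (of_ne_one s)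
  rw [neg_mul, pos_mul]
  simp only [mul_assoc] at this ⊢
  exact .single this

end Reversing

/-! ### Completeness of the Artin presentation for reversing -/

variable {n : ℕ}

theorem len_cls_mul (u : FreeMonoid (Fin (n - 1))) (a : PresMonoid (artin n)) :
    len n (cls _ u * a) = u.length + len n a := by
  obtain ⟨v, rfl⟩ := cls_surjective _ a
  rw [← map_mul, len_cls, len_cls, length_mul]

/-- The common multiple bounds the reversing grid. Garside's lemma supplies the corner square for
the first letters; the three remaining rectangles have strictly shorter common multiples. -/
theorem exists_rev_of_mul_eq (m : ℕ) (u v : FreeMonoid (Fin (n - 1)))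
    (a b : PresMonoid (artin n)) (hm : len n (cls _ u * a) < m)
    (h : cls _ u * a = cls _ v * b) :
    ∃ u' v' c, Rev (artin n) (neg u * pos v) (pos v' * neg u') ∧
      a = cls _ v' * c ∧ b = cls _ u' * c := by
  induction m generalizing u v a b with
  | zero => omega
  | succ m IH =>
    cases u using FreeMonoid.casesOn with
    | one =>
      rw [map_one, one_mul] at h
      exact ⟨1, v, b, by rw [neg_one, one_mul, mul_one]; exact .refl, h, by rw [map_one, one_mul]⟩
    | of_mul s u =>
    cases v using FreeMonoid.casesOn with
    | one =>
      rw [map_one, one_mul] at h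
      exact ⟨.of s * u, 1, a, by rw [pos_one, one_mul, mul_one]; exact .refl, by rw [map_one, one_mul], h.symm⟩
    | of_mul t v =>
    rw [map_mul, mul_assoc] at h hm
    rw [map_mul _ (FreeMonoid.of t), mul_assoc] at h
    change len n (gen n s * _) < _ at hm
    change gen n s * _ = gen n t * _ at h
    rw [len_gen_mul] at hm
    have key : ∀ c d e, IsRel (artin n) (.of s * c) (.of t * d) → cls _ u * a = cls _ c * e →
        cls _ v * b = cls _ d * e → ∃ u' v' c,
        Rev (artin n) (neg (.of s * u) * pos (.of t * v)) (pos v' * neg u') ∧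
          a = cls _ v' * c ∧ b = cls _ u' * c := by
      intro c d e hrel hc hd
      -- Homogeneity gives `c` and `d` equal length, so the bound on `u a = c e` passes to `d e = v
      -- b`.
      have hl := (Eqv.length_eq (cls_eq_iff.1 (cls_eq_of_isRel hrel)))
      rw [length_mul, length_mul, length_of, length_of] at hl
      obtain ⟨u₁, c₁, z₁, hr₁, ha₁, he₁⟩ := IH _ _ _ _ (by omega) hc
      have hm' : len n (cls _ d * e) < m := by
        have := congrArg (len n) hc
        rw [len_cls_mul _ e] at this
        rw [len_cls_mul]; omega
      obtain ⟨d₁, v₁, z₂, hr₂, he₂, hb₂⟩ := IH d v e b hm' hd.symm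
      have hm'' : len n (cls _ u₁ * z₁) < m := by
        rw [← he₁]; rw [len_cls_mul] at hm'; omega
      obtain ⟨u₂, v₂, z, hr, hz₁, hz₂⟩ := IH _ _ _ _ hm'' (he₁.symm.trans he₂)
      refine ⟨d₁ * u₂, c₁ * v₂, z, (rev_letters hrel u v).trans ?_, ?_, ?_⟩
      · have h₁ := hr₁.mul_mul 1 (neg d * pos v)
        have h₂ := hr₂.mul_mul (pos c₁ * neg u₁) 1
        have h₃ := hr.mul_mul (pos c₁) (neg d₁)
        simp only [one_mul, mul_one, mul_assoc, pos_mul, neg_mul] at h₁ h₂ h₃ ⊢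
        exact h₁.trans (h₂.trans h₃)
      · rw [ha₁, hz₁, map_mul, mul_assoc]
      · rw [hb₂, hz₂, map_mul, mul_assoc]
    rcases meet_of_gen_mul_eq h with ⟨rfl, h'⟩ | ⟨hst, w, h₁, h₂⟩ | ⟨hst, w, h₁, h₂⟩
    · obtain ⟨u', v', c, hr, hc⟩ := IH u v a b (by omega) h'
      exact ⟨u', v', c, (rev_letter_self s u v).trans hr, hc⟩
    · refine key (σ t * σ s) (σ s * σ t) w ?_ ?_ ?_
      · rw [← mul_assoc, ← mul_assoc]; exact isRel_adj hst
      · rw [h₁, map_mul, mul_assoc]; rfl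
      · rw [h₂, map_mul, mul_assoc]; rfl
    · exact key (σ t) (σ s) w (isRel_far hst) h₁ h₂

theorem rComplete_artin (n : ℕ) : RComplete (artin n) := by
  intro u v h
  have h := cls_eq_iff.2 h
  rw [← mul_one (cls _ u), ← mul_one (cls _ v)] at h
  obtain ⟨u', v', c, hr, h₁, h₂⟩ := exists_rev_of_mul_eq _ u v 1 1 (Nat.lt_succ_self _) h
  have h₁ := congrArg (len n) h₁
  have h₂ := congrArg (len n) h₂
  rw [len_cls_mul, len_one] at h₁ h₂
  obtain rfl : v' = 1 := length_eq_zero.1 (by omega)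
  obtain rfl : u' = 1 := length_eq_zero.1 (by omega)
  exact hr

/-! ### Normal words and the reduced Groebner basis -/

/-- `w` is the smallest word of its class. -/
def IsNormal {S : Type*} (lt : FreeMonoid S → FreeMonoid S → Prop) (R : Rels S)
    (w : FreeMonoid S) : Prop :=
  ∀ w', Eqv R w w' → ¬ lt w' w

/-- The pairs of a minimal non-normal word and the normal word of its class. -/
def canonicalBasis {S : Type*} (lt : FreeMonoid S → FreeMonoid S → Prop) (R : Rels S) : Rels S :=
  {p | Eqv R p.1 p.2 ∧ lt p.2 p.1 ∧ IsNormal lt R p.2 ∧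
    ∀ u, IsSubword u p.1 → u ≠ p.1 → IsNormal lt R u}

section Groebner

variable {S : Type*}

theorem Eqv.symm {R : Rels S} {u v : FreeMonoid S} (h : Eqv R u v) : Eqv R v u := ConGen.Rel.symm h

theorem Eqv.trans {R : Rels S} {u v w : FreeMonoid S} (h : Eqv R u v) (h' : Eqv R v w) :
    Eqv R u w := ConGen.Rel.trans h h'

theorem IsSubword.refl (u : FreeMonoid S) : IsSubword u u := ⟨1, 1, by simp⟩

theorem IsSubword.trans {u v w : FreeMonoid S} (h : IsSubword u v) (h' : IsSubword v w) :
    IsSubword u w := by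
  obtain ⟨x, y, rfl⟩ := h
  obtain ⟨x', y', rfl⟩ := h'
  exact ⟨x' * x, y * y', by simp only [mul_assoc]⟩

theorem IsSubword.eq_of_length_le {u v : FreeMonoid S} (h : IsSubword u v)
    (hl : v.length ≤ u.length) : u = v := by
  obtain ⟨x, y, rfl⟩ := h
  rw [length_mul, length_mul] at hl
  obtain rfl : x = 1 := length_eq_zero.1 (by omega)
  obtain rfl : y = 1 := length_eq_zero.1 (by omega)
  simp

variable {r : S → S → Prop}

theorem DegLex.length_le {u v : FreeMonoid S} (h : DegLex r u v) : u.length ≤ v.length := by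
  rcases List.shortlex_def.1 h with h | h
  · exact h.le
  · exact h.1.le

/-- Appending on the right can break a lexicographic comparison when one word is a proper prefix of
the other; equal lengths exclude this. -/
theorem DegLex.mul_mul_of_length_eq {u v : FreeMonoid S} (h : DegLex r u v)
    (hl : u.length = v.length) (x y : FreeMonoid S) : DegLex r (x * u * y) (x * v * y) := by
  rw [DegLex, toList_mul, toList_mul, toList_mul, toList_mul, List.append_assoc, List.append_assoc]
  refine List.Shortlex.append_left ?_ _
  change u.toList.length = v.toList.length at hl
  have h : List.Lex r u.toList v.toList := (List.shortlex_iff_lex hl).1 h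
  refine List.Shortlex.of_lex (by simp [hl]) ?_
  generalize u.toList = u at *
  generalize v.toList = v at *
  induction h with
  | nil => simp at hl
  | cons _ ih => exact .cons (ih (by simpa using hl))
  | rel h => exact .rel h

theorem DegLex.mul_mul {u v : FreeMonoid S} (h : DegLex r u v) (x y : FreeMonoid S) :
    DegLex r (x * u * y) (x * v * y) := by
  rcases h.length_le.lt_or_eq with hl | hl
  · refine List.Shortlex.of_length_lt ?_
    change (x * u * y).length < (x * v * y).length
    simp only [length_mul]; omega
  · exact h.mul_mul_of_length_eq hl x y

theorem degLex_of_head {a b : S} (h : r a b) {u v : FreeMonoid S} (hl : u.length = v.length) :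
    DegLex r (.of a * u) (.of b * v) :=
  List.Shortlex.of_lex (congrArg Nat.succ hl) (.rel h)

variable {R : Rels S}

theorem isNormal_one : IsNormal (DegLex r) R 1 :=
  fun _ _ h => List.not_shortlex_nil_right h

theorem IsNormal.of_isSubword {u w : FreeMonoid S} (hw : IsNormal (DegLex r) R w)
    (h : IsSubword u w) : IsNormal (DegLex r) R u := by
  obtain ⟨x, y, rfl⟩ := h
  intro u' hu hlt
  exact hw (x * u' * y) (.mul (.mul (.refl _) hu) (.refl _)) (hlt.mul_mul x y)

theorem exists_minimal_not_isNormal {w : FreeMonoid S} (hw : ¬ IsNormal (DegLex r) R w) :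
    ∃ u, IsSubword u w ∧ ¬ IsNormal (DegLex r) R u ∧
      ∀ v, IsSubword v u → v ≠ u → IsNormal (DegLex r) R v := by
  obtain ⟨u, ⟨hu, hn⟩, hmin⟩ := (measure FreeMonoid.length).wf.has_min
    {u | IsSubword u w ∧ ¬ IsNormal (DegLex r) R u} ⟨w, .refl w, hw⟩
  refine ⟨u, hu, hn, fun v hv hne => by_contra fun h => hne ?_⟩
  exact hv.eq_of_length_le (not_lt.1 (hmin v ⟨hv.trans hu, h⟩))

/-- A proper block misses the first or the last letter, so minimality of a non-normal word needs
only two checks. -/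
theorem isNormal_of_isSubword_of_ne {s t : S} {u v : FreeMonoid S}
    (h : FreeMonoid.of s * u = v * .of t) (hu : IsNormal (DegLex r) R u)
    (hv : IsNormal (DegLex r) R v) (w : FreeMonoid S) (hw : IsSubword w (.of s * u))
    (hne : w ≠ .of s * u) : IsNormal (DegLex r) R w := by
  obtain ⟨x, y, hxy⟩ := hw
  cases x using FreeMonoid.casesOn with
  | one =>
    rw [one_mul] at hxy
    rcases List.eq_nil_or_concat y.toList with hy | ⟨z, c, hy⟩
    · refine absurd ?_ hne
      rw [hxy, show y = 1 from hy, mul_one]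
    · have hy : y = ofList z * .of c := hy.trans List.concat_eq_append
      have : w * ofList z = v := by
        have h' : (w * ofList z).toList ++ [c] = v.toList ++ [t] := by
          change (w * ofList z) * .of c = v * .of t
          rw [← h, hxy, hy, mul_assoc]
        exact (List.append_inj' h' rfl).1
      exact hv.of_isSubword ⟨1, ofList z, by rw [one_mul, this]⟩
  | of_mul c x =>
    rw [mul_assoc, mul_assoc] at hxy
    exact hu.of_isSubword ⟨x, y, by rw [(of_mul_inj.1 hxy).2, mul_assoc]⟩

variable [IsStrictTotalOrder S r]

theorem degLex_asymm {u v : FreeMonoid S} (h : DegLex r u v) : ¬ DegLex r v u :=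
  (List.Shortlex.asymm (r := r)).asymm _ _ h

theorem degLex_trichotomous (u v : FreeMonoid S) : DegLex r u v ∨ u = v ∨ DegLex r v u :=
  trichotomous_of (List.Shortlex r) u.toList v.toList

theorem degLex_of_mul_iff {a : S} {u v : FreeMonoid S} :
    DegLex r (.of a * u) (.of a * v) ↔ DegLex r u v :=
  List.shortlex_cons_iff

theorem IsNormal.eq_of_eqv {u v : FreeMonoid S} (hu : IsNormal (DegLex r) R u)
    (hv : IsNormal (DegLex r) R v) (h : Eqv R u v) : u = v := by
  rcases degLex_trichotomous (r := r) u v with h' | h' | h'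
  · exact absurd h' (hv _ h.symm)
  · exact h'
  · exact absurd h' (hu _ h)

theorem exists_isNormal [Finite S] (u : FreeMonoid S) :
    ∃ v, Eqv R u v ∧ IsNormal (DegLex r) R v := by
  have wf : WellFounded (DegLex r) :=
    List.Shortlex.wf (Finite.wellFounded_of_trans_of_irrefl r)
  obtain ⟨v, hv, hmin⟩ := wf.has_min {v | Eqv R u v} ⟨u, .refl u⟩
  exact ⟨v, hv, fun w hw => hmin w (hv.trans hw)⟩

/-- Deglex is a well-order on a finite alphabet, so classes have normal words and every non-normal
word contains a minimal one. -/
theorem isReducedGroebnerBasis_canonicalBasis [Finite S] :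
    IsReducedGroebnerBasis (DegLex r) R (canonicalBasis (DegLex r) R) := by
  refine ⟨⟨fun p h => h.1, fun p h => h.2.1, fun w w' h hlt => ?_⟩, ?_⟩
  · obtain ⟨u, hu, hn, hp⟩ := exists_minimal_not_isNormal fun hw => hw w' h hlt
    obtain ⟨v, hv, hvn⟩ := exists_isNormal (r := r) (R := R) u
    refine ⟨(u, v), ⟨hv, ?_, hvn, hp⟩, hu⟩
    rcases degLex_trichotomous (r := r) u v with h' | rfl | h'
    · exact absurd h' (hvn _ hv.symm)
    · exact absurd hvn hn
    · exact h'
  · rintro p hp q hq hne ⟨hlt, h | h⟩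
    · by_cases he : q.1 = p.1
      · exact hne (Prod.ext he (hq.2.2.1.eq_of_eqv hp.2.2.1 (hq.1.symm.trans (he ▸ hp.1))))
      · exact hp.2.2.2 _ h he _ hq.1 hlt
    · exact hp.2.2.1.of_isSubword h _ hq.1 hlt

/-- Non-normal words contain a leading word of `G`, so reducedness makes right sides normal and left
sides minimal. Conversely, a minimal non-normal word must itself be a leading word, and its normal
partner is unique. -/
theorem eq_canonicalBasis {G : Rels S} (hG : IsReducedGroebnerBasis (DegLex r) R G) :
    G = canonicalBasis (DegLex r) R := by
  obtain ⟨⟨heqv, hor, hex⟩, hred⟩ := hG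
  have hex' : ∀ w, ¬ IsNormal (DegLex r) R w → ∃ p ∈ G, IsSubword p.1 w := by
    intro w hw
    simp only [IsNormal, not_forall, not_not] at hw
    obtain ⟨w', h, hlt⟩ := hw
    exact hex w w' h hlt
  have hsub : G ⊆ canonicalBasis (DegLex r) R := by
    refine fun p hp => ⟨heqv p hp, hor p hp, by_contra fun hn => ?_, fun u hu hne => ?_⟩
    · obtain ⟨q, hq, hs⟩ := hex' _ hn
      by_cases hqp : q = p
      · subst hqp
        have he := hs.eq_of_length_le (hor q hq).length_le
        have := hor q hq
        rw [← he] at this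
        exact degLex_asymm this this
      · exact hred p hp q hq hqp ⟨hor q hq, .inr hs⟩
    · by_contra hn
      obtain ⟨q, hq, hs⟩ := hex' _ hn
      refine hred p hp q hq ?_ ⟨hor q hq, .inl (hs.trans hu)⟩
      rintro rfl
      refine hne (hu.eq_of_length_le ?_)
      obtain ⟨x, y, rfl⟩ := hs
      simp only [length_mul]; omega
  refine hsub.antisymm fun p hp => ?_
  obtain ⟨q, hq, hs⟩ := hex' p.1 fun h => h _ hp.1 hp.2.1
  have hq' := hsub hq
  have he : q.1 = p.1 := by_contra fun hne => hp.2.2.2 _ hs hne _ hq'.1 hq'.2.1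
  have : q = p := Prod.ext he (hq'.2.2.1.eq_of_eqv hp.2.2.1 (hq'.1.symm.trans (he ▸ hp.1)))
  exact this ▸ hq

end Groebner

/-! ### Normal words in braid monoids -/

section Braid

variable {n : ℕ} {r : Fin (n - 1) → Fin (n - 1) → Prop} [IsStrictTotalOrder (Fin (n - 1)) r]

/-- A smaller equivalent word cannot start with `s`, by cancellation and normality of `w`. It starts
with a smaller letter, which occurs in `w` because equivalent words have the same letters. -/
theorem IsNormal.of_mul {s : Fin (n - 1)} {w : FreeMonoid (Fin (n - 1))}
    (hw : IsNormal (DegLex r) (artin n) w)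
    (h : ∀ c a, r c s → c ∈ w → gen n s * cls _ w ≠ gen n c * a) :
    IsNormal (DegLex r) (artin n) (.of s * w) := by
  intro w' he hlt
  have hl := he.length_eq
  cases w' using FreeMonoid.casesOn with
  | one => rw [length_mul, length_of, length_one] at hl; omega
  | of_mul c x =>
    have hl' : w.length = x.length := by
      rw [length_mul, length_mul, length_of, length_of] at hl; omega
    have he' := cls_eq_iff.2 he
    rw [map_mul, map_mul] at he'
    rcases trichotomous_of r c s with hc | rfl | hc
    · refine h c _ hc ?_ he'
      have := (he.mem_iff c).2 (mem_mul.2 (.inl mem_of_self))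
      rcases mem_mul.1 this with h | h
      · rw [mem_of] at h
        subst h
        exact absurd hc (irrefl_of r c)
      · exact h
    · exact hw x (cls_eq_iff.1 (meet_of_gen_mul_eq he').cancel) (degLex_of_mul_iff.1 hlt)
    · exact degLex_asymm hlt (degLex_of_head hc hl')

theorem IsNormal.of_mul_of_le {s : Fin (n - 1)} {w : FreeMonoid (Fin (n - 1))}
    (hw : IsNormal (DegLex r) (artin n) w) (h : ∀ c ∈ w, c = s ∨ r s c) :
    IsNormal (DegLex r) (artin n) (.of s * w) := by
  refine hw.of_mul fun c a hc hm _ => ?_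
  rcases h c hm with rfl | h
  · exact irrefl_of r c hc
  · exact asymm_of r hc h

theorem eq_of_mem_pow {s c : Fin (n - 1)} {k : ℕ} (h : c ∈ σ s ^ k) : c = s := by
  induction k with
  | zero => exact absurd h notMem_one
  | succ k ih =>
    rw [pow_succ, mem_mul, mem_of] at h
    exact h.elim ih id

theorem IsNormal.pow_mul_of_le {s : Fin (n - 1)} {w : FreeMonoid (Fin (n - 1))}
    (hw : IsNormal (DegLex r) (artin n) w) (h : ∀ c ∈ w, c = s ∨ r s c) (k : ℕ) :
    IsNormal (DegLex r) (artin n) (σ s ^ k * w) := by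
  induction k with
  | zero => simpa using hw
  | succ k ih =>
    rw [pow_succ', mul_assoc]
    refine ih.of_mul_of_le fun c hc => ?_
    rcases mem_mul.1 hc with hc | hc
    · exact .inl (eq_of_mem_pow hc)
    · exact h c hc

theorem isNormal_pow (s : Fin (n - 1)) (k : ℕ) : IsNormal (DegLex r) (artin n) (σ s ^ k) := by
  simpa using isNormal_one.pow_mul_of_le (r := r) (s := s) (fun c hc => absurd hc notMem_one) k

theorem isNormal_of (s : Fin (n - 1)) : IsNormal (DegLex r) (artin n) (σ s) := by
  simpa using isNormal_pow (r := r) s 1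

theorem cls_pow (s : Fin (n - 1)) (k : ℕ) : cls (artin n) (σ s ^ k) = gen n s ^ k :=
  map_pow _ _ _

theorem gen_mul_ne_one (s : Fin (n - 1)) (z : PresMonoid (artin n)) : gen n s * z ≠ 1 := by
  intro h
  have := congrArg (len n) h
  rw [len_gen_mul, len_one] at this
  omega

/-! ### Words in two adjacent generators, and the infinite family -/

variable {a b : Fin (n - 1)}

/-- Descent on `k`: Garside's lemma strips one `a` and returns an equation of the same shape. -/
theorem pow_mul_ne_mul_mul (h : Adj a b) (k : ℕ) (z : PresMonoid (artin n)) :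
    gen n a ^ k * gen n b ≠ gen n b * (gen n a * z) := by
  induction k generalizing z with
  | zero =>
    intro he
    rw [pow_zero, one_mul, ← mul_one (gen n b), mul_assoc, one_mul] at he
    exact gen_mul_ne_one _ _ (meet_of_gen_mul_eq he).cancel.symm
  | succ k ih =>
    intro he
    rw [pow_succ', mul_assoc] at he
    obtain ⟨w, hw, -⟩ := (meet_of_gen_mul_eq he).of_adj h
    exact ih w hw

theorem pow_mul_ne_mul (h : Adj a b) {k : ℕ} (hk : k ≠ 0) (z : PresMonoid (artin n)) :
    gen n a ^ k * gen n b ≠ gen n b * z := by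
  obtain ⟨k, rfl⟩ := Nat.exists_eq_succ_of_ne_zero hk
  intro he
  rw [Nat.succ_eq_add_one, pow_succ', mul_assoc] at he
  obtain ⟨w, hw, -⟩ := (meet_of_gen_mul_eq he).of_adj h
  exact pow_mul_ne_mul_mul h k w hw

theorem pow_ne_mul (h : Adj a b) (k : ℕ) (z : PresMonoid (artin n)) :
    gen n b ^ k ≠ gen n a * z := by
  induction k generalizing z with
  | zero => exact (gen_mul_ne_one _ _).symm
  | succ k ih =>
    intro he
    rw [pow_succ'] at he
    obtain ⟨w, hw, -⟩ := (meet_of_gen_mul_eq he).of_adj h.symm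
    exact ih _ hw

theorem pow_ne_mul_mul (h : Adj a b) (k : ℕ) (z : PresMonoid (artin n)) :
    gen n b ^ k ≠ gen n b * (gen n a * z) := by
  cases k with
  | zero => exact (gen_mul_ne_one _ _).symm
  | succ k =>
    intro he
    rw [pow_succ'] at he
    exact pow_ne_mul h k z (meet_of_gen_mul_eq he).cancel

/-- A word starting with `b` followed by a normal word in `a` and `b` is normal if it is not
equivalent to a word starting with `a`. -/
theorem IsNormal.of_mul_of_adj (h : Adj a b) {w : FreeMonoid (Fin (n - 1))}
    (hw : IsNormal (DegLex r) (artin n) w) (hm : ∀ c ∈ w, c = a ∨ c = b)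
    (hz : ∀ z, cls _ w ≠ gen n a * (gen n b * z)) :
    IsNormal (DegLex r) (artin n) (.of b * w) := by
  refine hw.of_mul fun c x hc hcm he => ?_
  rcases hm c hcm with rfl | rfl
  · obtain ⟨w, h₁, -⟩ := (meet_of_gen_mul_eq he).of_adj h.symm
    exact hz w h₁
  · exact irrefl_of r _ hc

theorem isNormal_mul_of_adj (h : Adj a b) : IsNormal (DegLex r) (artin n) (σ b * σ a) := by
  refine (isNormal_of a).of_mul_of_adj h (fun c hc => .inl (mem_of.1 hc)) fun z he => ?_
  rw [← mul_one (cls _ _)] at he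
  exact gen_mul_ne_one _ _ (meet_of_gen_mul_eq he).cancel.symm

/-- After cancelling an `a`, non-normality would make `a^(k-1) b` a right multiple of `b`. The bound
on `k` is sharp, as `bab = aba`. -/
theorem isNormal_mul_pow_mul (h : Adj a b) (hr : r a b) {k : ℕ} (hk : 2 ≤ k) :
    IsNormal (DegLex r) (artin n) (σ b * (σ a ^ k * σ b)) := by
  refine IsNormal.of_mul_of_adj h ?_ (fun c hc => ?_) fun z he => ?_
  · exact (isNormal_of b).pow_mul_of_le (fun c hc => .inr (mem_of.1 hc ▸ hr)) k
  · rcases mem_mul.1 hc with hc | hc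
    · exact .inl (eq_of_mem_pow hc)
    · exact .inr (mem_of.1 hc)
  · obtain ⟨k, rfl⟩ := Nat.exists_eq_add_of_le' hk
    rw [map_mul, cls_pow, pow_succ', mul_assoc] at he
    exact pow_mul_ne_mul h (Nat.succ_ne_zero _) _ (meet_of_gen_mul_eq he).cancel

theorem isNormal_mul_mul_sq_mul_pow (h : Adj a b) (hr : r a b) (k : ℕ) :
    IsNormal (DegLex r) (artin n) (σ a * (σ b * (σ a ^ 2 * σ b ^ k))) := by
  have hm : ∀ c ∈ σ a ^ 2 * σ b ^ k, c = a ∨ c = b := by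
    intro c hc
    rcases mem_mul.1 hc with hc | hc
    · exact .inl (eq_of_mem_pow hc)
    · exact .inr (eq_of_mem_pow hc)
  refine IsNormal.of_mul_of_le (IsNormal.of_mul_of_adj h ?_ hm fun z he => ?_) fun c hc => ?_
  · exact (isNormal_pow b k).pow_mul_of_le (fun c hc => .inr (eq_of_mem_pow hc ▸ hr)) 2
  · rw [map_mul, cls_pow, cls_pow, pow_two, mul_assoc] at he
    have he := (meet_of_gen_mul_eq he).cancel
    obtain ⟨w, hw, -⟩ := (meet_of_gen_mul_eq he).of_adj h
    exact pow_ne_mul_mul h k w hw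
  · rcases mem_mul.1 hc with hc | hc
    · exact .inr (mem_of.1 hc ▸ hr)
    · rcases hm c hc with rfl | rfl
      · exact .inl rfl
      · exact .inr hr

/-- Iterates `a · ba = ba · b`: moving past `ba` turns each `a` into a `b`. -/
theorem gen_pow_mul (h : Adj a b) (k : ℕ) (z : PresMonoid (artin n)) :
    gen n a ^ k * (gen n b * (gen n a * z)) = gen n b * (gen n a * (gen n b ^ k * z)) := by
  induction k generalizing z with
  | zero => simp
  | succ k ih => rw [pow_succ, mul_assoc, gen_braid h, ih, pow_succ, mul_assoc]

theorem eqv_family (h : Adj a b) (k : ℕ) :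
    Eqv (artin n) (σ b * (σ a ^ (k + 1) * (σ b * σ a)))
      (σ a * (σ b * (σ a ^ 2 * σ b ^ k))) := by
  rw [← cls_eq_iff]
  simp only [map_mul, map_pow]
  change gen n b * (gen n a ^ (k + 1) * (gen n b * gen n a)) =
    gen n a * (gen n b * (gen n a ^ 2 * gen n b ^ k))
  have := gen_pow_mul h (k + 1) 1
  rw [mul_one, mul_one] at this
  -- `b·bab·b^k = b·aba·b^k = bab·a b^k = aba·a b^k`.
  rw [this, pow_succ', ← gen_braid h, gen_braid h.symm, pow_two, mul_assoc]

theorem length_pow {S : Type*} (u : FreeMonoid S) (k : ℕ) : (u ^ k).length = k * u.length := by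
  induction k with
  | zero => simp
  | succ k ih => rw [pow_succ, length_mul, ih, Nat.succ_mul]

theorem family_mem (h : Adj a b) (hr : r a b) {k : ℕ} (hk : 2 ≤ k) :
    (σ b * σ a ^ k * σ b * σ a, σ a * σ b * σ a ^ 2 * σ b ^ (k - 1)) ∈
      canonicalBasis (DegLex r) (artin n) := by
  have he := eqv_family h (k - 1)
  rw [Nat.sub_add_cancel (by omega)] at he
  simp only [mul_assoc]
  refine ⟨he, ?_, isNormal_mul_mul_sq_mul_pow h hr _, ?_⟩
  · refine degLex_of_head hr ?_
    have := he.length_eq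
    rw [length_mul, length_mul (σ a), length_of, length_of] at this
    exact (Nat.add_left_cancel this).symm
  -- The maximal proper blocks are `a^k b a` and `b a^k b`.
  · refine isNormal_of_isSubword_of_ne (t := a) (v := σ b * (σ a ^ k * σ b)) ?_ ?_
      (isNormal_mul_pow_mul h hr hk)
    · simp only [mul_assoc]
    · refine (isNormal_mul_of_adj h).pow_mul_of_le (fun c hc => ?_) k
      rcases mem_mul.1 hc with hc | hc
      · exact .inr (mem_of.1 hc ▸ hr)
      · exact .inl (mem_of.1 hc)

theorem braid_mem (h : Adj a b) (hr : r a b) :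
    (σ b * σ a * σ b, σ a * σ b * σ a) ∈ canonicalBasis (DegLex r) (artin n) := by
  refine ⟨cls_eq_iff.1 (cls_eq_of_isRel (isRel_adj h.symm)), ?_, ?_, ?_⟩
  · simp only [mul_assoc]
    exact degLex_of_head hr rfl
  · simp only [mul_assoc]
    refine (isNormal_mul_of_adj h).of_mul_of_le fun c hc => ?_
    rcases mem_mul.1 hc with hc | hc
    · exact .inr (mem_of.1 hc ▸ hr)
    · exact .inl (mem_of.1 hc)
  · simp only [mul_assoc]
    exact isNormal_of_isSubword_of_ne (t := b) (v := σ b * σ a) (by simp only [mul_assoc])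
      (isNormal_mul_of_adj h.symm) (isNormal_mul_of_adj h)

theorem comm_mem (h : Far a b) (hr : r a b) :
    (σ b * σ a, σ a * σ b) ∈ canonicalBasis (DegLex r) (artin n) := by
  refine ⟨cls_eq_iff.1 (cls_eq_of_isRel (isRel_far h.symm)), degLex_of_head hr rfl, ?_, ?_⟩
  · exact (isNormal_of b).of_mul_of_le fun c hc => .inr (mem_of.1 hc ▸ hr)
  · exact isNormal_of_isSubword_of_ne rfl (isNormal_of a) (isNormal_of b)

theorem equations_artin_subset :
    equations (artin n) ⊆ equations (canonicalBasis (DegLex r) (artin n)) := by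
  rintro _ ⟨_, ⟨i, j, h, rfl⟩ | ⟨i, j, h, rfl⟩, rfl⟩
  · rw [← adj_iff] at h
    rcases trichotomous_of r i j with hr | rfl | hr
    · exact ⟨_, braid_mem h hr, Sym2.eq_swap⟩
    · exact absurd rfl h.ne
    · exact ⟨_, braid_mem h.symm hr, rfl⟩
  · rw [← far_iff] at h
    rcases trichotomous_of r i j with hr | rfl | hr
    · exact ⟨_, comm_mem h hr, Sym2.eq_swap⟩
    · exact absurd rfl h.ne
    · exact ⟨_, comm_mem h.symm hr, rfl⟩

theorem finite_equations_artin (n : ℕ) : (equations (artin n)).Finite := by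
  refine Set.Finite.image _ (.union ?_ ?_)
  · refine (Set.finite_range fun p : Fin (n - 1) × Fin (n - 1) =>
      (σ p.1 * σ p.2 * σ p.1, σ p.2 * σ p.1 * σ p.2)).subset ?_
    rintro _ ⟨i, j, -, rfl⟩
    exact ⟨(i, j), rfl⟩
  · refine (Set.finite_range fun p : Fin (n - 1) × Fin (n - 1) =>
      (σ p.1 * σ p.2, σ p.2 * σ p.1)).subset ?_
    rintro _ ⟨i, j, -, rfl⟩
    exact ⟨(i, j), rfl⟩

theorem infinite_equations_canonicalBasis (h : Adj a b) (hr : r a b) :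
    (equations (canonicalBasis (DegLex r) (artin n))).Infinite := by
  refine Set.infinite_of_injective_forall_mem (f := fun k : ℕ =>
    s(σ b * σ a ^ (k + 2) * σ b * σ a, σ a * σ b * σ a ^ 2 * σ b ^ (k + 2 - 1))) ?_ fun k =>
      ⟨_, family_mem h hr (Nat.le_add_left 2 k), rfl⟩
  intro k l he
  -- Both sides of the `k`-th equation have length `k + 5`, so either matching of sides gives `k =
  -- l`.
  rcases Sym2.eq_iff.1 he with ⟨he, -⟩ | ⟨he, -⟩ <;>
  · have := congrArg FreeMonoid.length he
    simp only [length_mul, length_pow, length_of] at this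
    omega

end Braid

end WordPres

theorem mainTheorem4 (n : ℕ) (hn : 3 ≤ n)
    (r : Fin (n - 1) → Fin (n - 1) → Prop) (hr : IsStrictTotalOrder (Fin (n - 1)) r) :
    WordPres.IsType1 (WordPres.DegLex r) (WordPres.artin n) ∧
    WordPres.RComplete (WordPres.artin n) ∧
    ∀ G : WordPres.Rels (Fin (n - 1)),
      WordPres.IsReducedGroebnerBasis (WordPres.DegLex r) (WordPres.artin n) G →
      ∀ a b : Fin (n - 1), |((b : ℕ) : ℤ) - ((a : ℕ) : ℤ)| = 1 → r a b →
      ∀ k : ℕ, 2 ≤ k →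
        (WordPres.σ b * WordPres.σ a ^ k * WordPres.σ b * WordPres.σ a,
          WordPres.σ a * WordPres.σ b * WordPres.σ a ^ 2 * WordPres.σ b ^ (k - 1)) ∈ G := by
  have hinf : (WordPres.equations
      (WordPres.canonicalBasis (WordPres.DegLex r) (WordPres.artin n))).Infinite := by
    -- Since `n ≥ 3`, indices `0` and `1` exist; the smaller generator for `r` plays the role of
    -- `a`.
    let i : Fin (n - 1) := ⟨0, by omega⟩
    let j : Fin (n - 1) := ⟨1, by omega⟩
    have hij : WordPres.Adj i j := .inl rfl
    rcases trichotomous_of r i j with h | h | h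
    · exact WordPres.infinite_equations_canonicalBasis hij h
    · exact absurd h hij.ne
    · exact WordPres.infinite_equations_canonicalBasis hij.symm h
  refine ⟨⟨⟨_, WordPres.isReducedGroebnerBasis_canonicalBasis,
    fun G hG => WordPres.eq_canonicalBasis hG⟩, fun G hG => ?_⟩, WordPres.rComplete_artin n,
    fun G hG a b hab hr k hk => ?_⟩
  · rw [WordPres.eq_canonicalBasis hG,
      WordPres.rCompletion_of_rComplete (WordPres.rComplete_artin n)]
    refine ⟨WordPres.equations_artin_subset.ssubset_of_ne fun h => hinf ?_,
      WordPres.finite_equations_artin n, hinf⟩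
    exact h ▸ WordPres.finite_equations_artin n
  · rw [WordPres.eq_canonicalBasis hG]
    exact WordPres.family_mem ((WordPres.adj_iff a b).2 hab) hr hk
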